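/- Fix $n\in\mathbb{N}$. A continuum in $\mathbb{R}^n$ is a compact connected set $X\subseteq\mathbb{R}^n$; $d$ is the Euclidean metric, $B_\epsilon(p)$ is the open ball, and, for $p\in X$, $C_p(U)$ is the connected component of $p$ in $U\cap X$. A function $f:\mathbb{N}\to\mathbb{N}$ is an \emph{LC function} for $X$ if $X\cap B_{2^{-f(k)}}(p)\subseteq C_p(B_{2^{-k}}(p))$ for all $k\in\mathbb{N}$ and $p\in X$. A function $g:\mathbb{N}\to\mathbb{N}$ is a \emph{ULAC function} for $X$ if for every $k\in\mathbb{N}$ and all distinct $x,y\in X$ with $d(x,y)\le 2^{-g(k)}$ there is an arc in $X$ (a homeomorphic image of $[0,1]$) from $x$ to $y$ whose diameter is smaller than $2^{-k}$. The set $X$ is \emph{ELC} (respectively \emph{EULAC}) if it has a computable LC (respectively ULAC) function. A \emph{name} of a compact set $X\subseteq\mathbb{R}^n$ is an infinite list of exactly all (codes of) finite covers of $X$ by open rational boxes each of which contains at least one point of $X$; $X$ is \emph{computably compact} if it is compact and has a computable name. A \emph{name} of a function $f:\mathbb{N}\to\mathbb{N}$ consists of the code of an oracle machine $M$ and an oracle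 $A\subseteq\mathbb{N}$ such that $M$ computes $f$ when supplied with the oracle $A$. Then: (1) From a name of a continuum $X\subseteq\mathbb{R}^n$ and a name of an LC function for $X$, one can uniformly compute a name of a ULAC function for $X$. That is, there is a single oracle machine that, for every continuum $X\subseteq\mathbb{R}^n$, every LC function $f$ for $X$, every name of $X$ and every name of $f$, transforms this pair of names into a name of some ULAC function for $X$. (2) Every computably compact ELC continuum $X\subseteq\mathbb{R}^n$ is EULAC. -/

import Mathlib

open Set Metric

/-! ### Oracle machines -/

/-- Programs for oracle machines on natural numbers: the usual basis for the partial recursive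
functions together with one instruction that queries the oracle. -/
inductive OracleCode : Type
  | zero : OracleCode
  | succ : OracleCode
  | left : OracleCode
  | right : OracleCode
  | oracle : OracleCode
  | pair : OracleCode → OracleCode → OracleCode
  | comp : OracleCode → OracleCode → OracleCode
  | prec : OracleCode → OracleCode → OracleCode
  | rfind : OracleCode → OracleCode

namespace OracleCode

/-- The partial function computed by a program that has access to the oracle `φ`
(the clauses are those of `Nat.RecursiveIn`). -/
def eval (φ : ℕ → ℕ) : OracleCode → ℕ →. ℕ
  | zero => fun _ => Part.some 0
  | succ => fun n => Part.some (n + 1)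
  | left => fun n => Part.some n.unpair.1
  | right => fun n => Part.some n.unpair.2
  | oracle => fun n => Part.some (φ n)
  | pair cf cg => fun n => Nat.pair <$> eval φ cf n <*> eval φ cg n
  | comp cf cg => fun n => eval φ cg n >>= eval φ cf
  | prec cf cg => fun p =>
      p.unpair.2.rec (eval φ cf p.unpair.1) fun y IH => do
        let i ← IH
        eval φ cg (Nat.pair p.unpair.1 (Nat.pair y i))
  | rfind cf => fun a => Nat.rfind fun n => (fun m => decide (m = 0)) <$> eval φ cf (Nat.pair a n)

/-- The Gödel number of a program. -/
def toNat : OracleCode → ℕ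
  | zero => 0
  | succ => 1
  | left => 2
  | right => 3
  | oracle => 4
  | pair cf cg => 4 * Nat.pair cf.toNat cg.toNat + 5
  | comp cf cg => 4 * Nat.pair cf.toNat cg.toNat + 6
  | prec cf cg => 4 * Nat.pair cf.toNat cg.toNat + 7
  | rfind cf => 4 * cf.toNat + 8

/-- A program can be recovered from its Gödel number. -/
theorem toNat_injective : Function.Injective toNat := by
  intro a
  induction a with
  | zero | succ | left | right | oracle =>
    intro b h; cases b <;> simp only [toNat] at h <;> first | rfl | omega
  | pair f g hf hg | comp f g hf hg | prec f g hf hg =>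
    intro b h
    cases b <;> simp only [toNat] at h <;> try omega
    rename_i f' g'
    have h' : Nat.pair f.toNat g.toNat = Nat.pair f'.toNat g'.toNat := by omega
    rw [Nat.pair_eq_pair] at h'
    rw [hf h'.1, hg h'.2]
  | rfind f hf =>
    intro b h
    cases b <;> simp only [toNat] at h <;> try omega
    rename_i f'
    rw [hf (show f.toNat = f'.toNat by omega)]

end OracleCode

/-! ### Names and computation on names

A name is an infinite sequence `ℕ → ℕ`. -/

/-- The program `c`, reading the infinite sequence `p` (any entry can be queried), writes the
infinite sequence `q`: it halts on every position `i`, with the entry `q i`. -/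
def Transforms (c : OracleCode) (p q : ℕ → ℕ) : Prop :=
  ∀ i, q i ∈ c.eval p i

/-- The sequence `p 0, q 0, p 1, q 1, …`, by which a pair of names is presented to a machine. -/
def interleave (p q : ℕ → ℕ) : ℕ → ℕ := fun i =>
  if i % 2 = 0 then p (i / 2) else q (i / 2)

/-- The characteristic function of a set of natural numbers. -/
noncomputable def charFun (A : Set ℕ) : ℕ → ℕ := A.indicator 1

/-- `p` is a name of `f : ℕ → ℕ`: it consists of the Gödel number of an oracle machine `c`,
followed by the characteristic sequence of an oracle `A ⊆ ℕ`, such that `c` computes `f` when it is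
supplied with the oracle `A`. -/
def IsFunctionName (p f : ℕ → ℕ) : Prop :=
  ∃ (c : OracleCode) (A : Set ℕ), p 0 = c.toNat ∧ (∀ i, p (i + 1) = charFun A i) ∧
    ∀ n, f n ∈ c.eval (charFun A) n

/-- Data of an `n`-dimensional rational box: `n` pairs of rationals `a i < b i`. -/
abbrev RationalBox (n : ℕ) : Type := Fin n → {ab : ℚ × ℚ // ab.1 < ab.2}

/-- The open box `(a 1, b 1) × ⋯ × (a n, b n)` in Euclidean space. -/
def RationalBox.toSet {n : ℕ} (B : RationalBox n) : Set (EuclideanSpace ℝ (Fin n)) :=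
  {x | ∀ i, (((B i).1.1 : ℚ) : ℝ) < x i ∧ x i < (((B i).1.2 : ℚ) : ℝ)}

/-- A finite sequence of rational boxes is a minimal cover of `X` if it covers `X` and each of its
members contains a point of `X`. -/
def IsMinimalCover {n : ℕ} (X : Set (EuclideanSpace ℝ (Fin n)))
    (L : List (RationalBox n)) : Prop :=
  (X ⊆ ⋃ B ∈ L, B.toSet) ∧ ∀ B ∈ L, (X ∩ B.toSet).Nonempty

/-- The code of a rational number: its numerator and its denominator in lowest terms. -/
def ratCode (q : ℚ) : ℕ := Nat.pair (Encodable.encode q.num) q.den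

/-- The code of a rational box: the list of the codes of its sides `(a i, b i)`. -/
def RationalBox.code {n : ℕ} (B : RationalBox n) : ℕ :=
  Encodable.encode (List.ofFn fun i => Nat.pair (ratCode (B i).1.1) (ratCode (B i).1.2))

/-- The code of a finite sequence of rational boxes. -/
def coverCode {n : ℕ} (L : List (RationalBox n)) : ℕ :=
  Encodable.encode (L.map RationalBox.code)

/-- `p` is a name of the compact set `X`: a list of (the codes of) exactly all
finite minimal covers of `X` by rational boxes. -/
def IsCompactName {n : ℕ} (p : ℕ → ℕ) (X : Set (EuclideanSpace ℝ (Fin n))) : Prop :=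
  Set.range p = coverCode '' {L : List (RationalBox n) | IsMinimalCover X L}

/-! ### Local connectivity -/

/-- A continuum in Euclidean space: a compact connected set (the empty set is not excluded). -/
def IsEuclideanContinuum {n : ℕ} (X : Set (EuclideanSpace ℝ (Fin n))) : Prop :=
  IsCompact X ∧ IsPreconnected X

/-- `f` is a local connectivity function for `X`. -/
def IsLCFunction {n : ℕ} (X : Set (EuclideanSpace ℝ (Fin n))) (f : ℕ → ℕ) : Prop :=
  ∀ k : ℕ, ∀ p ∈ X, X ∩ ball p ((2 : ℝ) ^ (-(f k : ℤ))) ⊆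
    connectedComponentIn (ball p ((2 : ℝ) ^ (-(k : ℤ))) ∩ X) p

/-- `A` is an arc from `x` to `y`: a homeomorphic image of `[0,1]` with endpoints `x` and `y`. -/
def IsArcFromTo {n : ℕ} (A : Set (EuclideanSpace ℝ (Fin n)))
    (x y : EuclideanSpace ℝ (Fin n)) : Prop :=
  ∃ h : unitInterval ≃ₜ A, (h 0 : EuclideanSpace ℝ (Fin n)) = x ∧
    (h 1 : EuclideanSpace ℝ (Fin n)) = y

/-- `g` is a uniform local arcwise connectivity function for `X`. -/
def IsULACFunction {n : ℕ} (X : Set (EuclideanSpace ℝ (Fin n))) (g : ℕ → ℕ) : Prop :=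
  ∀ k : ℕ, ∀ x ∈ X, ∀ y ∈ X, x ≠ y → dist x y ≤ (2 : ℝ) ^ (-(g k : ℤ)) →
    ∃ A ⊆ X, IsArcFromTo A x y ∧ diam A < (2 : ℝ) ^ (-(k : ℤ))

/-- `X` is computably compact: it has a computable name. -/
def IsComputablyCompact {n : ℕ} (X : Set (EuclideanSpace ℝ (Fin n))) : Prop :=
  IsCompact X ∧ ∃ p : ℕ → ℕ, Computable p ∧ IsCompactName p X

/-- `X` is effectively locally connected. -/
def IsELC {n : ℕ} (X : Set (EuclideanSpace ℝ (Fin n))) : Prop :=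
  ∃ f : ℕ → ℕ, Computable f ∧ IsLCFunction X f

/-- `X` is effectively uniformly locally arcwise connected. -/
def IsEULAC {n : ℕ} (X : Set (EuclideanSpace ℝ (Fin n))) : Prop :=
  ∃ g : ℕ → ℕ, Computable g ∧ IsULACFunction X g

/-! If `f` is an LC function for `X`, then `k ↦ f (k + 3) + 1` is a ULAC function, so on names only
the program code has to be edited. Points of `X` closer than `2 ^ (-f (k + 3 + j))` lie in a
connected subset of `X` of radius `2 ^ (-(k + 3 + j))`, and connected sets contain chains with
arbitrarily small steps. Starting from the single step `x, y`, each chain is refined inside such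
sets to one with finer steps. The displacements are summable, so the chains, read as step functions
on `[0,1]`, converge uniformly to a path in the closed set `X` that stays near `x`
(`exists_path_of_locally_connected`). A path with distinct ends contains an arc
(`exists_injective_path`): a minimal closed set of parameters, found by Zorn's lemma, erases all
loops; a monotone parameter then collapses the intervals of constancy. -/

/-! ### Oracle programs and names -/

/-- Every primitive recursive function is computed by a program that ignores its oracle. -/
theorem Nat.Primrec.exists_oracleCode {f : ℕ → ℕ} (hf : Nat.Primrec f) :
    ∃ c : OracleCode, ∀ o n, c.eval o n = Part.some (f n) := by
  induction hf with
  | zero => exact ⟨.zero, fun _ _ => rfl⟩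
  | succ => exact ⟨.succ, fun _ _ => rfl⟩
  | left => exact ⟨.left, fun _ _ => rfl⟩
  | right => exact ⟨.right, fun _ _ => rfl⟩
  | pair _ _ hf hg =>
    obtain ⟨cf, hf⟩ := hf
    obtain ⟨cg, hg⟩ := hg
    exact ⟨.pair cf cg, fun o n => by simp [OracleCode.eval, hf, hg, Seq.seq]⟩
  | @comp f g _ _ hf hg =>
    obtain ⟨cf, hf⟩ := hf
    obtain ⟨cg, hg⟩ := hg
    refine ⟨.comp cf cg, fun o n => ?_⟩
    exact (congrArg (Part.bind · (cf.eval o)) (hg o n)).trans ((Part.bind_some _ _).trans (hf _ _))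
  | prec _ _ hf hg =>
    obtain ⟨cf, hf⟩ := hf
    obtain ⟨cg, hg⟩ := hg
    refine ⟨.prec cf cg, fun o n => ?_⟩
    simp only [OracleCode.eval, Nat.unpaired]
    induction n.unpair.2 with
    | zero => exact hf _ _
    | succ k ih =>
      dsimp only at ih ⊢
      rw [ih]
      exact (Part.bind_some _ _).trans (hg _ _)

namespace OracleCode

/-- A program that computes `n ↦ f (n + 3) + 1` if `c` computes `f`. -/
def shiftThreeSucc (c : OracleCode) : OracleCode :=
  .comp .succ (.comp c (.comp .succ (.comp .succ .succ)))

theorem mem_eval_shiftThreeSucc {o f : ℕ → ℕ} {c : OracleCode}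
    (h : ∀ n, f n ∈ c.eval o n) (n : ℕ) : f (n + 3) + 1 ∈ c.shiftThreeSucc.eval o n := by
  have h₁ : (OracleCode.comp .succ (.comp .succ .succ)).eval o n = Part.some (n + 3) := by
    simp [eval, Part.bind_eq_bind, Part.bind_some]
  refine Part.mem_bind (Part.mem_bind (a := n + 3) ?_ (h _)) (Part.mem_some _)
  exact h₁ ▸ Part.mem_some _

/-- A program turning the pair formed by any name and a name of `f` into a name of
`n ↦ f (n + 3) + 1`. -/
theorem exists_transforms_shift :
    ∃ c : OracleCode, ∀ f p r : ℕ → ℕ, IsFunctionName r f →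
      ∃ q, Transforms c (interleave p r) q ∧ IsFunctionName q fun n => f (n + 3) + 1 := by
  -- Entry `0` is the code `m` of a program and becomes the code of its `shiftThreeSucc`: `1` codes
  -- `succ` and `4 * _ + 6` codes `comp`. The later entries, the oracle, are copied.
  let d : ℕ := (OracleCode.comp .succ (.comp .succ .succ)).toNat
  let F : ℕ → ℕ → ℕ := fun i m =>
    if i = 0 then 4 * Nat.pair 1 (4 * Nat.pair m d + 6) + 6 else m
  have hF : Nat.Primrec (Nat.unpaired F) := by
    refine Primrec₂.unpaired'.2 ?_
    have hcode : Primrec fun x : ℕ × ℕ => 4 * Nat.pair 1 (4 * Nat.pair x.2 d + 6) + 6 :=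
      Primrec.nat_add.comp (Primrec.nat_mul.comp (Primrec.const 4)
        (Primrec₂.natPair.comp (Primrec.const 1) (Primrec.nat_add.comp (Primrec.nat_mul.comp
          (Primrec.const 4) (Primrec₂.natPair.comp Primrec.snd (Primrec.const d)))
            (Primrec.const 6)))) (Primrec.const 6)
    exact Primrec.ite (Primrec.eq.comp Primrec.fst (Primrec.const 0)) hcode Primrec.snd
  have hodd : Nat.Primrec fun n => 2 * n + 1 := Primrec.nat_iff.1
    (Primrec.succ.comp (Primrec.nat_mul.comp (Primrec.const 2) Primrec.id))
  obtain ⟨cF, hcF⟩ := hF.exists_oracleCode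
  obtain ⟨ci, hci⟩ := (Primrec.nat_iff.1 Primrec.id).exists_oracleCode
  obtain ⟨co, hco⟩ := hodd.exists_oracleCode
  refine ⟨.comp cF (.pair ci (.comp .oracle co)), fun f p r hr => ?_⟩
  refine ⟨fun i => F i (r i), fun i => ?_, ?_⟩
  · have hr' : interleave p r (2 * i + 1) = r i := by
      have h₁ : (2 * i + 1) % 2 ≠ 0 := by omega
      have h₂ : (2 * i + 1) / 2 = i := by omega
      simp [interleave, h₂]
    have h₁ : (OracleCode.comp .oracle co).eval (interleave p r) i = Part.some (r i) := by
      refine (congrArg (Part.bind · (OracleCode.oracle.eval _)) (hco _ i)).trans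
        ((Part.bind_some _ _).trans ?_)
      exact congrArg Part.some hr'
    have h₂ : (OracleCode.pair ci (.comp .oracle co)).eval (interleave p r) i =
        Part.some (Nat.pair i (r i)) := by
      refine (congrArg₂ (fun a b => Nat.pair <$> a <*> b) (hci _ i) h₁).trans ?_
      simp [Seq.seq]
    refine Part.mem_bind (a := Nat.pair i (r i)) (h₂ ▸ Part.mem_some _) ?_
    rw [hcF]
    simp
  · obtain ⟨c, A, h0, hA, hc⟩ := hr
    refine ⟨c.shiftThreeSucc, A, ?_, fun i => ?_, mem_eval_shiftThreeSucc hc⟩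
    · simp [F, d, h0, shiftThreeSucc, toNat]
    · simp [F, hA]

end OracleCode

open Filter Topology unitInterval

/-! ### From paths to arcs -/

section Arcs

/-- A closed set of parameters that contains both ends and such that `γ` agrees at the ends of each
of its gaps. -/
structure IsLoopErasure {E : Type*} (γ : I → E) (A : Set I) : Prop where
  isClosed : IsClosed A
  zero_mem : 0 ∈ A
  one_mem : 1 ∈ A
  eq_of_gap : ∀ a ∈ A, ∀ b ∈ A, a < b → Ioo a b ∩ A = ∅ → γ a = γ b

/-- A gap that is not already a gap of `A` contains a removed point of `A`; this forces its ends to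
be `a` and `b`. -/
theorem IsLoopErasure.diff_Ioo {E : Type*} {γ : I → E} {A : Set I} (hA : IsLoopErasure γ A) {a b : I}
    (ha : a ∈ A) (hb : b ∈ A) (h : γ a = γ b) : IsLoopErasure γ (A \ Ioo a b) where
  isClosed := hA.isClosed.sdiff isOpen_Ioo
  zero_mem := ⟨hA.zero_mem, fun h => not_lt_bot h.1⟩
  one_mem := ⟨hA.one_mem, fun h => not_top_lt h.2⟩
  eq_of_gap := by
    rintro c ⟨hc, hc'⟩ d ⟨hd, hd'⟩ hcd hgap
    rcases eq_empty_or_nonempty (Ioo c d ∩ A) with he | ⟨e, he, heA⟩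
    · exact hA.eq_of_gap c hc d hd hcd he
    have hin : ∀ x ∈ A, c < x → x < d → a < x ∧ x < b := fun x hx h₁ h₂ => by
      by_contra hx'
      exact (hgap.le ⟨⟨h₁, h₂⟩, hx, hx'⟩ : x ∈ (∅ : Set I))
    have heab := hin e heA he.1 he.2
    have hca : c ≤ a := by
      by_contra! hlt
      exact hc' ⟨hlt, he.1.trans heab.2⟩
    have hbd : b ≤ d := by
      by_contra! hlt
      exact hd' ⟨heab.1.trans he.2, hlt⟩
    have hca' : c = a := by
      by_contra hne
      exact (hin a ha (lt_of_le_of_ne hca hne) (heab.1.trans he.2)).1.false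
    have hbd' : b = d := by
      by_contra hne
      exact (hin b hb (he.1.trans heab.2) (lt_of_le_of_ne hbd hne)).2.false
    rw [hca', ← hbd', h]

variable {E : Type*} [MetricSpace E]

/-- Gives the lower bounds for Zorn's lemma. By compactness, some member of the chain misses a
slightly shrunken gap `[a', b']` of the intersection. Its own gap around `[a', b']` has ends near
`a` and `b`, where `γ` agrees, so `γ a` and `γ b` are arbitrarily close. -/
theorem IsLoopErasure.sInter {γ : I → E} (hγ : Continuous γ) {c : Set (Set I)}
    (hc : ∀ A ∈ c, IsLoopErasure γ A) (hchain : IsChain (· ⊆ ·) c) (hne : c.Nonempty) :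
    IsLoopErasure γ (⋂₀ c) where
  isClosed := isClosed_sInter fun A hA => (hc A hA).isClosed
  zero_mem := fun A hA => (hc A hA).zero_mem
  one_mem := fun A hA => (hc A hA).one_mem
  eq_of_gap := by
    intro a ha b hb hab hgap
    refine eq_of_forall_dist_le fun ε hε => ?_
    obtain ⟨m, ham, hmb⟩ := exists_between hab
    have hna : ∀ᶠ x in 𝓝[≥] a, dist (γ x) (γ a) < ε / 2 :=
      (tendsto_nhds.1 (hγ.tendsto a) _ (half_pos hε)).filter_mono nhdsWithin_le_nhds
    have hnb : ∀ᶠ x in 𝓝[≤] b, dist (γ x) (γ b) < ε / 2 :=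
      (tendsto_nhds.1 (hγ.tendsto b) _ (half_pos hε)).filter_mono nhdsWithin_le_nhds
    obtain ⟨u, ⟨hau, hum⟩, hu⟩ := (mem_nhdsGE_iff_exists_mem_Ioc_Ico_subset ham).1 hna
    obtain ⟨v, ⟨hmv, hvb⟩, hv⟩ := (mem_nhdsLE_iff_exists_mem_Ico_Ioc_subset hmb).1 hnb
    obtain ⟨a', haa', ha'u⟩ := exists_between hau
    obtain ⟨b', hvb', hbb'⟩ := exists_between hvb
    have : Nonempty c := hne.to_subtype
    obtain ⟨⟨A, hAc⟩, hA⟩ := (isCompact_Icc (a := a') (b := b')).elim_directed_family_closed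
      (fun A : c => (A : Set I)) (fun A => (hc A A.2).isClosed)
      (by
        rw [← sInter_eq_iInter, ← subset_empty_iff, ← hgap]
        exact inter_subset_inter_left _ fun x hx =>
          ⟨haa'.trans_le hx.1, hx.2.trans_lt hbb'⟩)
      (fun A B => (hchain.total A.2 B.2).elim (fun h => ⟨A, Subset.rfl, h⟩)
        fun h => ⟨B, h, Subset.rfl⟩)
    have hE := hc A hAc
    have hs : sSup (A ∩ Iic a') ∈ A ∩ Iic a' :=
      (hE.isClosed.inter isClosed_Iic).sSup_mem ⟨a, ha A hAc, haa'.le⟩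
    have hi : sInf (A ∩ Ici b') ∈ A ∩ Ici b' :=
      (hE.isClosed.inter isClosed_Ici).sInf_mem ⟨b, hb A hAc, hbb'.le⟩
    have hs' : a ≤ sSup (A ∩ Iic a') := le_sSup ⟨ha A hAc, haa'.le⟩
    have hi' : sInf (A ∩ Ici b') ≤ b := sInf_le ⟨hb A hAc, hbb'.le⟩
    have heq := hE.eq_of_gap _ hs.1 _ hi.1
      (hs.2.trans_lt ((ha'u.trans_le (hum.trans hmv)).trans (hvb'.trans_le hi.2))) (by
        rw [eq_empty_iff_forall_notMem]
        rintro x ⟨⟨h₁, h₂⟩, hx⟩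
        have h₃ : a' < x := by
          by_contra! h
          exact (le_sSup (show x ∈ A ∩ Iic a' from ⟨hx, h⟩)).not_gt h₁
        have h₄ : x < b' := by
          by_contra! h
          exact (sInf_le (show x ∈ A ∩ Ici b' from ⟨hx, h⟩)).not_gt h₂
        exact (hA.le ⟨⟨h₃.le, h₄.le⟩, hx⟩ : x ∈ (∅ : Set I)))
    have d₁ : dist (γ (sSup (A ∩ Iic a'))) (γ a) < ε / 2 := hu ⟨hs', hs.2.trans_lt ha'u⟩
    have d₂ : dist (γ (sInf (A ∩ Ici b'))) (γ b) < ε / 2 := hv ⟨hvb'.trans_le hi.2, hi'⟩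
    rw [← heq] at d₂
    linarith [dist_triangle_left (γ a) (γ b) (γ (sSup (A ∩ Iic a')))]

/-- A path can be changed into one without proper loops: if it takes the same value twice then it
is constant in between. -/
theorem exists_path_const_between {γ : I → E} (hγ : Continuous γ) :
    ∃ δ : I → E, Continuous δ ∧ δ 0 = γ 0 ∧ δ 1 = γ 1 ∧ range δ ⊆ range γ ∧
      ∀ s t u, s ≤ u → u ≤ t → δ s = δ t → δ u = δ s := by
  obtain ⟨A, -, hA, hmin⟩ := zorn_superset_nonempty {A | IsLoopErasure γ A}
    (fun c hc hchain hne => ⟨⋂₀ c, IsLoopErasure.sInter hγ hc hchain hne,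
      fun _ => sInter_subset_of_mem⟩) univ
    ⟨isClosed_univ, mem_univ _, mem_univ _, fun a _ b _ hab h =>
      absurd ((inter_univ _).symm.trans h) (nonempty_Ioo.2 hab).ne_empty⟩
  have hgap : ∀ a ∈ A, ∀ b ∈ A, γ a = γ b → ∀ x ∈ A, x ∉ Ioo a b := fun a ha b hb h x hx =>
    (hmin (hA.diff_Ioo ha hb h) sdiff_subset hx).2
  -- `γ ∘ ρ` waits at the left end of each gap of `A`.
  let ρ : I → I := fun t => sSup (A ∩ Iic t)
  have hρ : ∀ t, ρ t ∈ A ∩ Iic t := fun t =>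
    (hA.isClosed.inter isClosed_Iic).sSup_mem ⟨0, hA.zero_mem, t.2.1⟩
  have hle : ∀ t, ∀ x ∈ A, x ≤ t → x ≤ ρ t := fun t x hx h => le_sSup ⟨hx, h⟩
  have hmono : Monotone ρ := fun s t hst => hle _ _ (hρ s).1 ((hρ s).2.trans hst)
  have hfix : ∀ t ∈ A, ρ t = t := fun t ht => le_antisymm (hρ t).2 (hle t t ht le_rfl)
  refine ⟨γ ∘ ρ, ?_, by simp [hfix 0 hA.zero_mem], by simp [hfix 1 hA.one_mem],
    range_comp_subset_range _ _, ?_⟩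
  · have huc := CompactSpace.uniformContinuous_of_continuous hγ
    refine (Metric.uniformContinuous_iff.2 fun ε hε => ?_).continuous
    obtain ⟨η, hη, h⟩ := Metric.uniformContinuous_iff.1 huc ε hε
    have key : ∀ s t : I, s ≤ t → dist s t < η → dist (γ (ρ s)) (γ (ρ t)) < ε := by
      intro s t hst hd
      rcases eq_or_ne (ρ s) (ρ t) with he | hne
      · rwa [he, dist_self]
      have hlt : s < ρ t := by
        by_contra! hge
        exact hne (le_antisymm (hmono hst) (hle _ _ (hρ t).1 hge))
      let τ := sInf (A ∩ Ici s)
      have hτ : τ ∈ A ∩ Ici s :=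
        (hA.isClosed.inter isClosed_Ici).sInf_mem ⟨1, hA.one_mem, s.2.2⟩
      have hτt : τ ≤ ρ t := sInf_le ⟨(hρ t).1, hlt.le⟩
      -- `ρ` may jump, but `γ` agrees at the ends `ρ s` and `τ` of a gap, and `τ` lies between `s`
      -- and `ρ t`.
      have heq : γ (ρ s) = γ τ := by
        rcases (show ρ s ≤ τ from mem_Iic.1 (hρ s).2 |>.trans (mem_Ici.1 hτ.2)).eq_or_lt with h | h
        · rw [h]
        refine hA.eq_of_gap _ (hρ s).1 _ hτ.1 h ?_
        rw [eq_empty_iff_forall_notMem]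
        rintro x ⟨⟨h₁, h₂⟩, hx⟩
        rcases le_total x s with hxs | hxs
        · exact (hle _ _ hx hxs).not_gt h₁
        · exact (sInf_le (show x ∈ A ∩ Ici s from ⟨hx, hxs⟩)).not_gt h₂
      rw [heq]
      refine h (lt_of_le_of_lt ?_ hd)
      have h₁ : (s : ℝ) ≤ τ := hτ.2
      have h₂ : (τ : ℝ) ≤ ρ t := hτt
      have h₃ : (ρ t : ℝ) ≤ t := (hρ t).2
      rw [Subtype.dist_eq, Subtype.dist_eq, Real.dist_eq, Real.dist_eq,
        abs_sub_comm, abs_of_nonneg (by linarith), abs_sub_comm, abs_of_nonneg (by linarith)]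
      linarith
    refine ⟨η, hη, fun s t hd => ?_⟩
    rcases le_total s t with hst | hst
    · exact key s t hst hd
    · rw [dist_comm] at hd ⊢
      exact key t s hst hd
  · intro s t u hsu hut heq
    have h₁ := hgap _ (hρ s).1 _ (hρ t).1 heq _ (hρ u).1
    rcases (hmono hsu).eq_or_lt with h | h
    · exact congrArg γ h.symm
    rcases (hmono hut).eq_or_lt with h' | h'
    · exact (congrArg γ h').trans heq.symm
    · exact absurd ⟨h, h'⟩ h₁

/-- The greatest distance from `δ p` to the values of `δ` between `p` and `t`. -/
noncomputable def excursion (δ : I → E) (p t : I) : ℝ :=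
  sSup ((fun s => dist (δ p) (δ (max p (min s t)))) '' univ)

theorem continuous_excursion {δ : I → E} (hδ : Continuous δ) (p : I) :
    Continuous (excursion δ p) :=
  isCompact_univ.continuous_sSup (f := fun t s => dist (δ p) (δ (max p (min s t))))
    (by fun_prop)

theorem dist_le_excursion' {δ : I → E} (hδ : Continuous δ) (p s t : I) :
    dist (δ p) (δ (max p (min s t))) ≤ excursion δ p t :=
  le_csSup (isCompact_univ.image (by fun_prop)).bddAbove ⟨s, mem_univ _, rfl⟩

theorem dist_le_excursion {δ : I → E} (hδ : Continuous δ) {p s t : I} (hps : p ≤ s)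
    (hst : s ≤ t) : dist (δ p) (δ s) ≤ excursion δ p t := by
  simpa [hst, hps] using dist_le_excursion' hδ p s t

theorem excursion_nonneg {δ : I → E} (hδ : Continuous δ) (p t : I) : 0 ≤ excursion δ p t :=
  dist_nonneg.trans (dist_le_excursion' hδ p p t)

theorem excursion_le {δ : I → E} {p t : I} {C : ℝ}
    (h : ∀ s, dist (δ p) (δ (max p (min s t))) ≤ C) : excursion δ p t ≤ C := by
  refine csSup_le (univ_nonempty.image _) ?_
  rintro _ ⟨s, -, rfl⟩
  exact h s

theorem excursion_eq_zero {δ : I → E} (hδ : Continuous δ) {p t : I} (h : t ≤ p) :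
    excursion δ p t = 0 :=
  le_antisymm (excursion_le fun s => by simp [(min_le_right s t).trans h])
    (excursion_nonneg hδ p t)

theorem excursion_mono {δ : I → E} (hδ : Continuous δ) (p : I) : Monotone (excursion δ p) := by
  intro t t' htt'
  refine excursion_le fun s => ?_
  have := dist_le_excursion' hδ p (min s t) t'
  rwa [min_assoc, min_eq_left htt'] at this

/-- After `s` the path only repeats the value `δ s`; if `p` itself lies in the constant stretch,
only the distance `0` occurs. -/
theorem excursion_eq_of_const {δ : I → E} (hδ : Continuous δ) {s t : I} (hst : s ≤ t)
    (h : ∀ u, s ≤ u → u ≤ t → δ u = δ s) (p : I) : excursion δ p t = excursion δ p s := by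
  refine le_antisymm (excursion_le fun u => ?_) (excursion_mono hδ p hst)
  rcases le_total t p with htp | htp
  · simp [(min_le_right u t).trans htp, excursion_nonneg hδ]
  have hvt : max p (min u t) ≤ t := max_le htp (min_le_right _ _)
  have hpv : p ≤ max p (min u t) := le_max_left _ _
  generalize max p (min u t) = v at hvt hpv
  rcases le_total v s with hvs | hvs
  · exact dist_le_excursion hδ hpv hvs
  rw [h v hvs hvt]
  rcases le_total p s with hps | hps
  · exact dist_le_excursion hδ hps le_rfl
  · rw [h p hps htp, dist_self]
    exact excursion_nonneg hδ p s

/-- A path that is constant between any two of its equal values has a monotone parameter which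
takes equal values exactly where the path does. -/
theorem exists_monotone_parameter {δ : I → E} (hδ : Continuous δ)
    (hconst : ∀ s t u, s ≤ u → u ≤ t → δ s = δ t → δ u = δ s) :
    ∃ f : I → ℝ, Continuous f ∧ Monotone f ∧ ∀ s t, f s = f t ↔ δ s = δ t := by
  obtain ⟨C, hC⟩ := Metric.isBounded_iff.1 (isCompact_range hδ).isBounded
  let p := TopologicalSpace.denseSeq I
  -- The parameter is a weighted sum of excursions from a dense set of base points. If `δ s ≠ δ t`,
  -- a base point just after `s` has excursion zero at `s` and positive at `t`.
  let F : ℕ → I → ℝ := fun n t => (1 / 2) ^ n * excursion δ (p n) t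
  have hF0 : ∀ n t, 0 ≤ F n t := fun n t => mul_nonneg (by positivity) (excursion_nonneg hδ _ _)
  have hbound : ∀ n t, ‖F n t‖ ≤ (1 / 2) ^ n * C := fun n t => by
    rw [Real.norm_of_nonneg (hF0 n t)]
    exact mul_le_mul_of_nonneg_left
      (excursion_le fun s => hC (mem_range_self _) (mem_range_self _)) (by positivity)
  have hsum : Summable fun n : ℕ => (1 / 2 : ℝ) ^ n * C := summable_geometric_two.mul_right C
  have hFsum : ∀ t, Summable fun n => F n t := fun t =>
    Summable.of_norm_bounded hsum fun n => hbound n t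
  have hFmono : ∀ n, Monotone (F n) := fun n s t hst =>
    mul_le_mul_of_nonneg_left (excursion_mono hδ _ hst) (by positivity)
  have hmono : Monotone fun t => ∑' n, F n t := fun s t hst =>
    (hFsum s).tsum_le_tsum (fun n => hFmono n hst) (hFsum t)
  have hlt : ∀ s t, s ≤ t → δ s ≠ δ t → ∑' n, F n s < ∑' n, F n t := by
    intro s t hst hne
    have hopen : IsOpen {x | δ x ≠ δ t} := isOpen_ne_fun hδ continuous_const
    have hst' : s < t := hst.lt_of_ne fun h => hne (congrArg δ h)
    obtain ⟨u, ⟨hsu, -⟩, hu⟩ := (mem_nhdsGE_iff_exists_mem_Ioc_Ico_subset hst').1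
      (mem_nhdsWithin_of_mem_nhds (hopen.mem_nhds hne))
    have hdense := (TopologicalSpace.denseRange_denseSeq I).exists_mem_open
      (isOpen_Ioo (a := s) (b := min u t)) (nonempty_Ioo.2 (lt_min hsu hst'))
    obtain ⟨n, hsn, hn⟩ := hdense
    have hnu : δ (p n) ≠ δ t := hu ⟨hsn.le, hn.trans_le (min_le_left _ _)⟩
    refine (hFsum s).tsum_lt_tsum (i := n) (fun m => hFmono m hst) ?_ (hFsum t)
    have hpos : 0 < excursion δ (p n) t := (dist_pos.2 hnu).trans_le
      (dist_le_excursion hδ (hn.trans_le (min_le_right _ _)).le le_rfl)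
    change _ * excursion δ (p n) s < _ * excursion δ (p n) t
    rw [excursion_eq_zero hδ hsn.le, mul_zero]
    positivity
  have heq : ∀ s t, s ≤ t → (∑' n, F n s = ∑' n, F n t ↔ δ s = δ t) := by
    refine fun s t hst => ⟨fun h => ?_, fun h => ?_⟩
    · by_contra hne
      exact (hlt s t hst hne).ne h
    · refine tsum_congr fun n => ?_
      simp only [F, excursion_eq_of_const hδ hst (fun u hsu hut => hconst s t u hsu hut h)]
  refine ⟨fun t => ∑' n, F n t, continuous_tsum
    (fun n => continuous_const.mul (continuous_excursion hδ _)) hsum hbound, hmono, fun s t => ?_⟩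
  rcases le_total s t with hst | hst
  · exact heq s t hst
  · rw [eq_comm, heq t s hst, eq_comm]

/-- The points of a path with distinct ends are joined by an injective path. -/
theorem exists_injective_path {γ : I → E} (hγ : Continuous γ) (hne : γ 0 ≠ γ 1) :
    ∃ h : I → E, Continuous h ∧ Function.Injective h ∧ h 0 = γ 0 ∧ h 1 = γ 1 ∧
      range h ⊆ range γ := by
  obtain ⟨δ, hδ, h0, h1, hrange, hconst⟩ := exists_path_const_between hγ
  obtain ⟨f, hf, hmono, hfeq⟩ := exists_monotone_parameter hδ hconst
  have hpos : 0 < f 1 - f 0 := sub_pos.2 <| (hmono unitInterval.nonneg').lt_of_ne fun h =>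
    hne (by rw [← h0, ← h1, (hfeq 0 1).1 h])
  have hmem : ∀ t, (f t - f 0) / (f 1 - f 0) ∈ I := fun t =>
    ⟨div_nonneg (sub_nonneg.2 (hmono unitInterval.nonneg')) hpos.le,
      (div_le_one hpos).2 (sub_le_sub_right (hmono unitInterval.le_one') _)⟩
  let F : I → I := fun t => ⟨(f t - f 0) / (f 1 - f 0), hmem t⟩
  have hF : Continuous F := ((hf.sub continuous_const).div_const _).subtype_mk _
  have hF0 : F 0 = 0 := Subtype.ext (by simp [F])
  have hF1 : F 1 = 1 := Subtype.ext (by simp [F, hpos.ne'])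
  have hFeq : ∀ s t, F s = F t ↔ δ s = δ t := fun s t => by
    rw [← hfeq, Subtype.ext_iff]
    simp [F, div_left_inj' hpos.ne']
  have hsurj : Function.Surjective F := fun y => by
    have := intermediate_value_univ 0 1 hF (show y ∈ Icc (F 0) (F 1) from
      ⟨hF0.trans_le unitInterval.nonneg', unitInterval.le_one'.trans_eq hF1.symm⟩)
    exact this
  -- `F` and `δ` have the same fibres, so `δ` descends along `F` to a continuous injective map.
  have hq : IsQuotientMap F := hF.isClosedMap.isQuotientMap hF hsurj
  let h : I → E := fun y => δ (Function.surjInv hsurj y)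
  have hh : ∀ t, h (F t) = δ t := fun t => (hFeq _ _).1 (Function.surjInv_eq hsurj (F t))
  refine ⟨h, ?_, fun y z hyz => ?_, ?_, ?_, ?_⟩
  · rw [hq.continuous_iff]
    exact hδ.congr fun t => (hh t).symm
  · rw [← Function.surjInv_eq hsurj y, ← Function.surjInv_eq hsurj z]
    exact (hFeq _ _).2 hyz
  · exact (congrArg h hF0.symm).trans ((hh 0).trans h0)
  · exact (congrArg h hF1.symm).trans ((hh 1).trans h1)
  · rintro _ ⟨y, rfl⟩
    exact hrange (mem_range_self _)

end Arcs

/-! ### Paths as limits of refined chains -/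

section Paths

variable {E : Type*} [MetricSpace E]

/-- Any two points of a connected set are joined by a chain with small steps. -/
theorem IsPreconnected.exists_chain {S : Set E} (hS : IsPreconnected S) {η : ℝ} (hη : 0 < η)
    {x y : E} (hx : x ∈ S) (hy : y ∈ S) :
    ∃ (M : ℕ) (c : ℕ → E), (x = y → M = 0) ∧ c 0 = x ∧ (∀ m, M ≤ m → c m = y) ∧
      (∀ m, c m ∈ S) ∧ ∀ m, dist (c m) (c (m + 1)) < η := by
  by_cases hxy : x = y
  · exact ⟨0, fun _ => y, fun _ => rfl, hxy.symm, fun _ _ => rfl, fun _ => hy, by simpa⟩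
  let R : E → E → Prop := fun a b => a ∈ S ∧ b ∈ S ∧ dist a b < η
  have hR : Relation.ReflTransGen R x y := by
    refine hS.induction₂ (Relation.ReflTransGen R) (fun a ha => ?_)
      (fun _ _ _ _ _ _ h h' => h.trans h') (fun a b _ _ h => ?_) hx hy
    · filter_upwards [self_mem_nhdsWithin, mem_nhdsWithin_of_mem_nhds (ball_mem_nhds a hη)]
        with b hb hab
      exact .single ⟨ha, hb, mem_ball'.1 hab⟩
    · have : Std.Symm R := ⟨fun a b ⟨ha, hb, h⟩ => ⟨hb, ha, dist_comm a b ▸ h⟩⟩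
      exact Std.Symm.symm _ _ h
  suffices ∃ (M : ℕ) (c : ℕ → E), c 0 = x ∧ (∀ m, M ≤ m → c m = y) ∧ (∀ m, c m ∈ S) ∧
      ∀ m, dist (c m) (c (m + 1)) < η by
    obtain ⟨M, c, h⟩ := this
    exact ⟨M, c, fun h => absurd h hxy, h⟩
  clear hx hxy
  induction hR using Relation.ReflTransGen.head_induction_on with
  | refl => exact ⟨0, fun _ => y, rfl, fun _ _ => rfl, fun _ => hy, by simpa⟩
  | @head a b hab _ ih =>
    obtain ⟨M, c, h0, hM, hcS, hc⟩ := ih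
    refine ⟨M + 1, fun m => Nat.casesOn m a c, rfl, fun m hm => ?_, fun m => ?_, fun m => ?_⟩
    · cases m with
      | zero => omega
      | succ m => exact hM m (by omega)
    · cases m with
      | zero => exact hab.1
      | succ m => exact hcS m
    · cases m with
      | zero => simpa [h0] using hab.2.2
      | succ m => exact hc m

/-- `x` is a chain in `X` with steps smaller than `η` that goes from `p` to `q` in `N` steps. -/
structure IsChainFromTo (X : Set E) (η : ℝ) (p q : E) (N : ℕ) (x : ℕ → E) : Prop where
  mem : ∀ m, x m ∈ X
  dist_lt : ∀ m, dist (x m) (x (m + 1)) < η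
  zero : x 0 = p
  eq_of_le : ∀ m, N ≤ m → x m = q

/-- If sufficiently close points of `X` lie in small connected subsets of `X` then every chain can
be refined to one with smaller steps. -/
theorem IsChainFromTo.exists_refinement {X : Set E} {η η' ε : ℝ} (hη' : 0 < η')
    (h : ∀ p ∈ X, ∀ q ∈ X, dist p q < η →
      ∃ S ⊆ X ∩ ball p ε, IsPreconnected S ∧ p ∈ S ∧ q ∈ S)
    {p q : E} {N : ℕ} {x : ℕ → E} (hx : IsChainFromTo X η p q N x) :
    ∃ (M : ℕ) (y : ℕ → E), 0 < M ∧ IsChainFromTo X η' p q (N * M) y ∧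
      ∀ m, dist (x (m / M)) (y m) < ε := by
  choose S hSX hS hS₀ hS₁ using fun i => h (x i) (hx.mem i) (x (i + 1)) (hx.mem _) (hx.dist_lt i)
  choose M c hM0 hc0 hcM hcS hc using fun i => (hS i).exists_chain hη' (hS₀ i) (hS₁ i)
  -- A common block length `K` makes refined indices compatible with division. It exists because the
  -- steps from `N` on are trivial and have `M i = 0`.
  obtain ⟨K, hK0, hK⟩ : ∃ K, 0 < K ∧ ∀ i, M i + 1 ≤ K := by
    refine ⟨∑ i ∈ Finset.range N, M i + 1, by omega, fun i => ?_⟩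
    rcases lt_or_ge i N with hi | hi
    · have := Finset.single_le_sum (f := M) (fun i _ => Nat.zero_le _) (Finset.mem_range.2 hi)
      omega
    · have := hM0 i (by rw [hx.eq_of_le i hi, hx.eq_of_le (i + 1) (by omega)])
      omega
  refine ⟨K, fun m => c (m / K) (m % K), hK0, ⟨fun m => (hSX _ (hcS _ _)).1, fun m => ?_, ?_,
    fun m hm => ?_⟩, fun m => mem_ball'.1 (hSX _ (hcS _ _)).2⟩
  · have hmod := Nat.mod_lt m hK0
    have hdiv := Nat.div_add_mod m K
    rcases Nat.lt_or_ge (m % K + 1) K with hlt | hge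
    · obtain ⟨h₁, h₂⟩ : (m + 1) / K = m / K ∧ (m + 1) % K = m % K + 1 :=
        (Nat.div_mod_unique hK0).2 ⟨by omega, hlt⟩
      simp only [h₁, h₂, hc]
    -- At the end of a block the subchain has already reached the start of the next one, since `K >
    -- M i`.
    · obtain ⟨h₁, h₂⟩ : (m + 1) / K = m / K + 1 ∧ (m + 1) % K = 0 :=
        (Nat.div_mod_unique hK0).2 ⟨by rw [mul_add]; omega, hK0⟩
      have := hK (m / K)
      simpa only [h₁, h₂, hc0, hcM (m / K) (m % K) (by omega), dist_self] using hη'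
  · simp [hc0, hx.zero]
  · have hi : N ≤ m / K := (Nat.le_div_iff_mul_le hK0).2 hm
    have hi' : x (m / K + 1) = q := hx.eq_of_le _ (by omega)
    have := hM0 (m / K) (by rw [hx.eq_of_le _ hi, hi'])
    exact (hcM _ _ (by omega)).trans hi'

/-- Nearby points of a closed set which is uniformly locally connected are joined by a path that
stays close to them. -/
theorem exists_path_of_locally_connected [CompleteSpace E] {X : Set E} (hX : IsClosed X)
    {η : ℕ → ℝ} {C : ℝ} (hη : ∀ j, 0 < η j) (hηC : ∀ j, η j ≤ C / 2 ^ j)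
    (h : ∀ j, ∀ p ∈ X, ∀ q ∈ X, dist p q < η j →
      ∃ S ⊆ X ∩ ball p (C / 2 / 2 ^ j), IsPreconnected S ∧ p ∈ S ∧ q ∈ S)
    {p q : E} (hp : p ∈ X) (hq : q ∈ X) (hpq : dist p q < η 0) :
    ∃ γ : I → E, Continuous γ ∧ γ 0 = p ∧ γ 1 = q ∧ ∀ t, γ t ∈ X ∧ dist p (γ t) ≤ C := by
  have : Nonempty E := ⟨p⟩
  have hstep : ∀ j (s : ℕ × (ℕ → E)), (0 < s.1 ∧ IsChainFromTo X (η j) p q s.1 s.2) →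
      ∃ s' : ℕ × (ℕ → E), (0 < s'.1 ∧ IsChainFromTo X (η (j + 1)) p q s'.1 s'.2) ∧
        ∃ M, 0 < M ∧ s'.1 = s.1 * M ∧ ∀ m, dist (s.2 (m / M)) (s'.2 m) < C / 2 / 2 ^ j := by
    rintro j ⟨N, x⟩ ⟨hN, hx⟩
    obtain ⟨M, y, hM, hy, hxy⟩ := hx.exists_refinement (hη (j + 1)) (h j)
    exact ⟨(N * M, y), ⟨Nat.mul_pos hN hM, hy⟩, M, hM, rfl, hxy⟩
  choose! next hnext hrel using hstep
  let s : ℕ → ℕ × (ℕ → E) := fun j => Nat.rec (1, fun m => if m = 0 then p else q) next j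
  have hs : ∀ j, 0 < (s j).1 ∧ IsChainFromTo X (η j) p q (s j).1 (s j).2 := by
    intro j
    induction j with
    | zero =>
      refine ⟨one_pos, fun m => ?_, fun m => ?_, rfl, fun m (hm : 1 ≤ m) => if_neg (by omega)⟩
      · change (if m = 0 then p else q) ∈ X
        split_ifs <;> assumption
      · change dist (if m = 0 then p else q) (if m + 1 = 0 then p else q) < _
        rcases eq_or_ne m 0 with rfl | hm
        · simpa
        · simpa [hm] using hη 0
    | succ j ih => exact hnext j _ ih
  -- Each chain length is a multiple of the previous one, so the floors nest under division.
  let F : ℕ → I → E := fun j t => (s j).2 ⌊(t : ℝ) * (s j).1⌋₊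
  have hF : ∀ t j, dist (F j t) (F (j + 1) t) ≤ C / 2 / 2 ^ j := by
    intro t j
    obtain ⟨M, hM, hN, hd⟩ := hrel j (s j) (hs j)
    have hM' : (M : ℝ) ≠ 0 := by positivity
    have hfl : ⌊(t : ℝ) * (s (j + 1)).1⌋₊ / M = ⌊(t : ℝ) * (s j).1⌋₊ := by
      rw [← Nat.floor_div_natCast, show (s (j + 1)).1 = (s j).1 * M from hN, Nat.cast_mul,
        ← mul_assoc, mul_div_cancel_right₀ _ hM']
    have := hd ⌊(t : ℝ) * (s (j + 1)).1⌋₊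
    rw [hfl] at this
    exact this.le
  choose γ hγ using fun t => cauchySeq_tendsto_of_complete (cauchySeq_of_le_geometric_two (hF t))
  have hFγ : ∀ t j, dist (F j t) (γ t) ≤ C / 2 ^ j := fun t j =>
    dist_le_of_le_geometric_two_of_tendsto (hF t) (hγ t) j
  have h0 : γ 0 = p := tendsto_nhds_unique (hγ 0)
    (tendsto_const_nhds.congr fun j => by simp [F, (hs j).2.zero])
  have h1 : γ 1 = q := tendsto_nhds_unique (hγ 1)
    (tendsto_const_nhds.congr fun j => by simp [F, (hs j).2.eq_of_le])
  refine ⟨γ, ?_, h0, h1, fun t =>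
    ⟨hX.mem_of_tendsto (hγ t) (.of_forall fun j => (hs j).2.mem _), ?_⟩⟩
  · refine Metric.continuous_iff.2 fun t ε hε => ?_
    -- The factor 3 covers two approximation errors and one chain step.
    obtain ⟨j, hj⟩ : ∃ j : ℕ, 3 * (C / 2 ^ j) < ε := by
      have : Tendsto (fun j : ℕ => 3 * (C / 2 ^ j)) atTop (𝓝 (3 * 0)) :=
        (tendsto_const_nhds.div_atTop (tendsto_pow_atTop_atTop_of_one_lt one_lt_two)).const_mul 3
      rw [mul_zero] at this
      exact (this.eventually_lt_const hε).exists
    have hN : (0 : ℝ) < (s j).1 := Nat.cast_pos.2 (hs j).1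
    have key : ∀ u v : I, u ≤ v → dist u v < 1 / (s j).1 → dist (F j u) (F j v) < η j := by
      intro u v huv hd
      have huv' : (u : ℝ) ≤ v := huv
      rw [Subtype.dist_eq, Real.dist_eq, abs_sub_comm, abs_of_nonneg (by linarith),
        lt_div_iff₀ hN] at hd
      have h₁ : ⌊(u : ℝ) * (s j).1⌋₊ ≤ ⌊(v : ℝ) * (s j).1⌋₊ := by gcongr
      have h₂ : ⌊(v : ℝ) * (s j).1⌋₊ ≤ ⌊(u : ℝ) * (s j).1⌋₊ + 1 := by
        rw [← Nat.floor_add_one (mul_nonneg u.2.1 hN.le)]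
        exact Nat.floor_le_floor (by linarith)
      rcases (by omega : ⌊(v : ℝ) * (s j).1⌋₊ = ⌊(u : ℝ) * (s j).1⌋₊ ∨
        ⌊(v : ℝ) * (s j).1⌋₊ = ⌊(u : ℝ) * (s j).1⌋₊ + 1) with he | he
      · simpa only [F, he, dist_self] using hη j
      · simpa only [F, he] using (hs j).2.dist_lt _
    refine ⟨1 / (s j).1, by positivity, fun u hu => ?_⟩
    have hd : dist (F j u) (F j t) < η j := by
      rcases le_total u t with hut | hut
      · exact key u t hut hu
      · rw [dist_comm] at hu ⊢
        exact key t u hut hu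
    have h₁ := hFγ u j
    have h₂ := hFγ t j
    have h₃ := hηC j
    have h₄ := dist_triangle4 (γ u) (F j u) (F j t) (γ t)
    rw [dist_comm (γ u) (F j u)] at h₄
    linarith
  -- The initial step function is `p` except at `t = 1`, where it is `q`.
  · rcases eq_or_ne t 1 with rfl | ht
    · rw [h1]
      simpa using hpq.le.trans (hηC 0)
    · have hfl : ⌊(t : ℝ) * (s 0).1⌋₊ = 0 := by
        have : (t : ℝ) < 1 := lt_of_le_of_ne t.2.2 fun h => ht (Subtype.ext h)
        simpa [s, Nat.floor_eq_zero] using this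
      simpa [F, hfl, (hs 0).2.zero] using hFγ t 0

end Paths

/-! ### The modulus and the main theorem -/

/-- A local connectivity function becomes a uniform local arcwise connectivity function when it is
shifted. -/
theorem IsLCFunction.isULACFunction {n : ℕ} {X : Set (EuclideanSpace ℝ (Fin n))} {f : ℕ → ℕ}
    (hX : IsClosed X) (hf : IsLCFunction X f) : IsULACFunction X fun k => f (k + 3) + 1 := by
  intro k x hx y hy hxy hd
  -- The radii `C / 2 / 2 ^ j` sum to `C = 2 ^ (-(k + 2))`, so the arc has diameter at most `2 * C`,
  -- which is half of `2 ^ (-k)`.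
  let C : ℝ := 2 * 2 ^ (-((k + 3 : ℕ) : ℤ))
  have hC : 0 < C := by positivity
  have hCj : ∀ j : ℕ, C / 2 / 2 ^ j = 2 ^ (-((k + 3 + j : ℕ) : ℤ)) := fun j => by
    simp only [C, zpow_neg, zpow_natCast, pow_add]
    field_simp
  let η : ℕ → ℝ := fun j => min (2 ^ (-(f (k + 3 + j) : ℤ))) (C / 2 ^ j)
  have hball : ∀ j, ∀ p ∈ X, ∀ q ∈ X, dist p q < 2 ^ (-(f (k + 3 + j) : ℤ)) →
      q ∈ connectedComponentIn (ball p (C / 2 / 2 ^ j) ∩ X) p := fun j p hp q hq h => by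
    rw [hCj]
    exact hf _ p hp ⟨hq, mem_ball'.2 h⟩
  -- The added `1` turns the weak inequality into the strict one that open balls require.
  have hd' : dist x y < 2 ^ (-(f (k + 3) : ℤ)) :=
    hd.trans_lt (zpow_lt_zpow_right₀ one_lt_two (by push_cast; omega))
  have hxyC : dist x y < C := by
    have := (connectedComponentIn_subset _ _ (hball 0 x hx y hy hd')).1
    rw [mem_ball', pow_zero, div_one] at this
    linarith
  obtain ⟨γ, hγ, h0, h1, hγX⟩ := exists_path_of_locally_connected hX (η := η) (C := C)
    (fun j => by positivity) (fun j => min_le_right _ _)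
    (fun j p hp q hq h => ⟨connectedComponentIn (ball p (C / 2 / 2 ^ j) ∩ X) p,
      (connectedComponentIn_subset _ _).trans_eq (inter_comm _ _),
      isPreconnected_connectedComponentIn,
      mem_connectedComponentIn ⟨mem_ball_self (by positivity), hp⟩,
      hball j p hp q hq (h.trans_le (min_le_left _ _))⟩) hx hy
    (lt_min hd' (by simpa using hxyC))
  obtain ⟨a, ha, hinj, ha0, ha1, hrange⟩ := exists_injective_path hγ (by rwa [h0, h1])
  have hsub : range a ⊆ X ∩ closedBall x C := by
    refine hrange.trans ?_
    rintro _ ⟨t, rfl⟩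
    exact ⟨(hγX t).1, mem_closedBall'.2 (hγX t).2⟩
  refine ⟨range a, hsub.trans inter_subset_left,
    ⟨(ha.isClosedEmbedding hinj).isEmbedding.toHomeomorph, ha0.trans h0, ha1.trans h1⟩, ?_⟩
  calc diam (range a) ≤ diam (closedBall x C) :=
        diam_mono (hsub.trans inter_subset_right) isBounded_closedBall
    _ ≤ 2 * C := diam_closedBall hC.le
    _ < 2 ^ (-(k : ℤ)) := by
        simp only [C, zpow_neg, zpow_natCast, pow_add]
        have : (0 : ℝ) < (2 ^ k)⁻¹ := by positivity
        rw [mul_inv]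
        linarith

theorem mainTheorem3 (n : ℕ) :
    (∃ c : OracleCode, ∀ (X : Set (EuclideanSpace ℝ (Fin n))) (f p r : ℕ → ℕ),
      IsEuclideanContinuum X → IsLCFunction X f → IsCompactName p X → IsFunctionName r f →
        ∃ q g : ℕ → ℕ, Transforms c (interleave p r) q ∧ IsFunctionName q g ∧
          IsULACFunction X g) ∧
    (∀ X : Set (EuclideanSpace ℝ (Fin n)),
      IsEuclideanContinuum X → IsComputablyCompact X → IsELC X → IsEULAC X) := by
  constructor
  · obtain ⟨c, hc⟩ := OracleCode.exists_transforms_shift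
    refine ⟨c, fun X f p r hX hf _ hr => ?_⟩
    obtain ⟨q, hq, hqf⟩ := hc f p r hr
    exact ⟨q, _, hq, hqf, hf.isULACFunction hX.1.isClosed⟩
  · rintro X hX - ⟨f, hf, hLC⟩
    exact ⟨_, (Primrec.succ.to_comp.comp (hf.comp (Primrec.nat_add.to_comp.comp
      Computable.id (Computable.const 3)))), hLC.isULACFunction hX.1.isClosed⟩
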